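/- Let $AG(4,3)$ be the affine geometry on $\mathbb{F}_3^4$. A \emph{cap} is a set of points of $AG(4,3)$ that contains no line, and a \emph{maximal cap} is a cap of largest possible size. A \emph{demicap} is a cap $D$ in $AG(4,3)$ consisting of five disjoint pairs of points such that the lines through these pairs all pass through a common point $a$ not in $D$, and no four of these five lines lie in a common hyperplane. Let $C$ be a maximal cap in $AG(4,3)$. If $D$ is a demicap with $D \subseteq C$, then $C \setminus D$ is also a demicap. Moreover, there are exactly $36$ unordered pairs $\{D, D'\}$ of disjoint demicaps with $D \cup D' = C$. -/

import Mathlib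

namespace AffineCap

/-- The points of the affine geometry `AG(4,3)`: the affine space over the vector space
`GF(3)^4`. -/
abbrev AG43 : Type := Fin 4 → ZMod 3

/-- A line of `AG(4,3)`: a one-dimensional affine subspace. (The empty subspace has direction
of dimension `0`.) -/
def IsLine (L : AffineSubspace (ZMod 3) AG43) : Prop :=
  Module.finrank (ZMod 3) L.direction = 1

/-- A hyperplane of `AG(4,3)`: a three-dimensional affine subspace. -/
def IsHyperplane (H : AffineSubspace (ZMod 3) AG43) : Prop :=
  Module.finrank (ZMod 3) H.direction = 3

/-- A cap: a set of points that contains no line. -/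
def IsCap (C : Finset AG43) : Prop :=
  ∀ L : AffineSubspace (ZMod 3) AG43, IsLine L → ¬ ((L : Set AG43) ⊆ (C : Set AG43))

/-- A maximal cap: a cap of largest possible size. -/
def IsMaximalCap (C : Finset AG43) : Prop :=
  IsCap C ∧ ∀ C' : Finset AG43, IsCap C' → C'.card ≤ C.card

/-- The pair `b, c` is an `a`-line: `{a, b, c}` is a line. (As a line has three points, `a`, `b`
and `c` are then distinct.) -/
def IsALine (a b c : AG43) : Prop :=
  ∃ L : AffineSubspace (ZMod 3) AG43, IsLine L ∧ (L : Set AG43) = {a, b, c}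

/-- `D` is a demicap with anchor point `a`: a cap that consists of five (disjoint) pairs of points
`d i, d' i`, each of which forms a line with `a`, such that no four of these five lines lie in
a common hyperplane. -/
def IsDemicapWithAnchor (a : AG43) (D : Finset AG43) : Prop :=
  IsCap D ∧ ∃ d d' : Fin 5 → AG43,
    Function.Injective (Sum.elim d d') ∧
    D = Finset.univ.image d ∪ Finset.univ.image d' ∧
    (∀ i, IsALine a (d i) (d' i)) ∧
    ∀ S : Finset (Fin 5), S.card = 4 →
      ¬ ∃ H : AffineSubspace (ZMod 3) AG43, IsHyperplane H ∧
        ∀ i ∈ S, a ∈ H ∧ d i ∈ H ∧ d' i ∈ H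

/-- A demicap: a demicap with some anchor point. -/
def IsDemicap (D : Finset AG43) : Prop :=
  ∃ a : AG43, IsDemicapWithAnchor a D

/-- The (unordered) ways `{D, D'}` to write `C` as the disjoint union of two demicaps. -/
def demicapDecompositions (C : Finset AG43) : Set (Sym2 (Finset AG43)) :=
  {p | ∃ D D' : Finset AG43, p = s(D, D') ∧
    IsDemicap D ∧ IsDemicap D' ∧ Disjoint D D' ∧ D ∪ D' = C}

end AffineCap

namespace AffineCap

local notation "𝔽" => ZMod 3

open Finset Module

/-! Over GF(3), three distinct points form a line exactly when their sum is 0, so caps can be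
studied by counting with linear functionals. Each nonzero functional cuts a cap into three parallel
slices. A functional vanishes at x + y + z always if the sum is 0, and for one third of the
functionals otherwise; hence weights depending only on slice sizes have a known average
(`LineFree.exists_dual_le`). A slicing of at most average weight, with slices bounded by the
lower-dimensional caps, has sizes 0+2+2, 1+4+4 or 2+9+9 for caps of 4, 9 or 20 points in dimension
2, 3 or 4. Shears fit the slices together, so these caps are unique up to affine equivalence:
`square`, `paraboloid`, `ellipticCap`. The last is complete, so every maximal cap is an image of it.

The elliptic cap consists of the pairs ±v over the ten points of an elliptic quadric in PG(3,3). No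
point but its centre can anchor five secants, so the demicaps inside it are the sets of five quadric
points with no four coplanar (`IsDemicap.exists_eq_transport`). The 30 four-point plane sections
form a Steiner system S(3,4,10). By inclusion-exclusion a 5-set contains as many blocks as its
complement, so the block-free 5-sets are closed under complement. A 5-set contains at most one
block, so 252 - 30·6 = 72 are block-free, giving 36 complementary pairs. These last facts are
verified by enumeration. -/

/-- A set without three distinct points on a line, in terms of the criterion that `x, y, z` form a
line of an affine space over `GF(3)` exactly if they are distinct and `x + y + z = 0`. -/
def LineFree {V : Type*} [AddCommGroup V] (C : Finset V) : Prop :=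
  ∀ x ∈ C, ∀ y ∈ C, ∀ z ∈ C, x + y + z = 0 → x = y

theorem LineFree.mono {V : Type*} [AddCommGroup V] {C D : Finset V} (hC : LineFree C)
    (h : D ⊆ C) : LineFree D :=
  fun x hx y hy z hz => hC x (h hx) y (h hy) z (h hz)

/-! ### Averaging over linear functionals -/

section Fourier

variable {V : Type*} [AddCommGroup V] [Module 𝔽 V]

theorem three_nsmul_eq_zero (x : V) : x + x + x = 0 := by
  have h : (3 : 𝔽) • x = x + x + x := by
    rw [show (3 : 𝔽) = 1 + 1 + 1 by decide, add_smul, add_smul, one_smul]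
  rw [← h, show (3 : 𝔽) = 0 by decide, zero_smul]

theorem LineFree.sum_eq_zero_iff {C : Finset V} (hC : LineFree C) {x y z : V} (hx : x ∈ C)
    (hy : y ∈ C) (hz : z ∈ C) : x + y + z = 0 ↔ y = x ∧ z = x := by
  constructor
  · intro h
    refine ⟨(hC x hx y hy z hz h).symm, hC z hz x hx y hy ?_⟩
    rw [← h]; abel
  · rintro ⟨rfl, rfl⟩
    exact three_nsmul_eq_zero _

theorem sum_comp_eq_sum_fibre {α : Type*} (C : Finset α) (f : α → 𝔽) (g : 𝔽 → ℕ) :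
    ∑ x ∈ C, g (f x) = ∑ c : 𝔽, #{x ∈ C | f x = c} * g c := by
  rw [← Finset.sum_fiberwise C f]
  refine Finset.sum_congr rfl fun c _ => ?_
  rw [Finset.sum_congr rfl (g := fun _ => g c), Finset.sum_const, smul_eq_mul]
  intro x hx
  rw [(Finset.mem_filter.1 hx).2]

theorem sum_zmod_three {M : Type*} [AddCommMonoid M] (g : 𝔽 → M) :
    ∑ c : 𝔽, g c = g 0 + g 1 + g 2 := Fin.sum_univ_three g

theorem prod_zmod_three {M : Type*} [CommMonoid M] (g : 𝔽 → M) :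
    ∏ c : 𝔽, g c = g 0 * g 1 * g 2 := Fin.prod_univ_three g

theorem card_eq_sum_fibre {α : Type*} (C : Finset α) (f : α → 𝔽) :
    #{x ∈ C | f x = 0} + #{x ∈ C | f x = 1} + #{x ∈ C | f x = 2} = #C := by
  have := sum_comp_eq_sum_fibre C f fun _ => 1
  rw [sum_zmod_three] at this
  simpa using this.symm

theorem sum_sub_eq_zero {α : Type*} (C : Finset α) (f : α → 𝔽) :
    ∑ x ∈ C, ∑ y ∈ C, (if f x - f y = 0 then 1 else 0) =
      #{x ∈ C | f x = 0} ^ 2 + #{x ∈ C | f x = 1} ^ 2 + #{x ∈ C | f x = 2} ^ 2 := by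
  rw [Finset.sum_congr rfl fun x _ =>
    sum_comp_eq_sum_fibre C f fun t => if f x - t = 0 then 1 else 0]
  rw [sum_comp_eq_sum_fibre C f fun s => ∑ c : 𝔽, #{x ∈ C | f x = c} * if s - c = 0 then 1 else 0]
  simp only [sum_zmod_three]
  simp [show (1 : 𝔽) - 2 ≠ 0 by decide, show (2 : 𝔽) - 1 ≠ 0 by decide,
    show (2 : 𝔽) ≠ 0 by decide]
  ring

/-- Three elements of GF(3) sum to 0 exactly when they are all equal or all distinct. -/
theorem sum_add_eq_zero {α : Type*} (C : Finset α) (f : α → 𝔽) :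
    ∑ x ∈ C, ∑ y ∈ C, ∑ z ∈ C, (if f x + f y + f z = 0 then 1 else 0) =
      #{x ∈ C | f x = 0} ^ 3 + #{x ∈ C | f x = 1} ^ 3 + #{x ∈ C | f x = 2} ^ 3 +
        6 * #{x ∈ C | f x = 0} * #{x ∈ C | f x = 1} * #{x ∈ C | f x = 2} := by
  rw [Finset.sum_congr rfl fun x _ => Finset.sum_congr rfl fun y _ =>
    sum_comp_eq_sum_fibre C f fun t => if f x + f y + t = 0 then 1 else 0]
  rw [Finset.sum_congr rfl fun x _ => sum_comp_eq_sum_fibre C f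
    fun s => ∑ c : 𝔽, #{x ∈ C | f x = c} * if f x + s + c = 0 then 1 else 0]
  rw [sum_comp_eq_sum_fibre C f fun r => ∑ d : 𝔽, #{x ∈ C | f x = d} *
    ∑ c : 𝔽, #{x ∈ C | f x = c} * if r + d + c = 0 then 1 else 0]
  simp only [sum_zmod_three]
  have h : ∀ a b c : 𝔽, (if a + b + c = 0 then 1 else 0 : ℕ) =
    if (a.val + b.val + c.val) % 3 = 0 then 1 else 0 := by decide
  simp only [h, show (0 : 𝔽).val = 0 from rfl, show (1 : 𝔽).val = 1 from rfl,
    show (2 : 𝔽).val = 2 from rfl]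
  norm_num
  ring

variable [Finite V]

noncomputable instance : Fintype (Dual 𝔽 V) :=
  @Fintype.ofFinite _ (Finite.of_injective (fun f : Dual 𝔽 V => (f : V → 𝔽)) DFunLike.coe_injective)

/-- Translation by multiples of a functional not vanishing at `d` permutes the three fibres of
evaluation at `d`, so they have equal size. -/
theorem card_dual_apply_eq_zero {d : V} (hd : d ≠ 0) :
    3 * #{f : Dual 𝔽 V | f d = 0} = Fintype.card (Dual 𝔽 V) := by
  classical
  obtain ⟨g, hg⟩ : ∃ g : Dual 𝔽 V, g d ≠ 0 := by
    by_contra! h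
    exact hd ((forall_dual_apply_eq_zero_iff 𝔽 d).1 h)
  have h : ∀ c : 𝔽, #{f : Dual 𝔽 V | f d = c} = #{f : Dual 𝔽 V | f d = 0} := by
    intro c
    refine Finset.card_bij (fun f _ => f - (c * (g d)⁻¹) • g) ?_ ?_ ?_
    · intro f hf
      have : f d = c := by simpa using hf
      simp [this, hg]
    · intro f _ f' _ h
      exact sub_left_injective h
    · intro f hf
      have : f d = 0 := by simpa using hf
      exact ⟨f + (c * (g d)⁻¹) • g, by simp [this, hg], by simp⟩
  have := card_eq_sum_fibre (univ : Finset (Dual 𝔽 V)) fun f => f d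
  rw [h 1, h 2, Finset.card_univ] at this
  omega

theorem card_dual : Fintype.card (Dual 𝔽 V) = 3 ^ finrank 𝔽 V := by
  have : Module.Finite 𝔽 V := .of_finite
  rw [Module.card_eq_pow_finrank (K := 𝔽), Subspace.dual_finrank_eq, ZMod.card]

/-- The sum over all functionals of the number of triples on which a functional has sum `0`. -/
theorem LineFree.sum_dual_triples {C : Finset V} (hC : LineFree C) :
    3 * ∑ f : Dual 𝔽 V, ∑ x ∈ C, ∑ y ∈ C, ∑ z ∈ C, (if f x + f y + f z = 0 then 1 else 0) =
      (#C ^ 3 + 2 * #C) * 3 ^ finrank 𝔽 V := by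
  classical
  rw [← card_dual (V := V)]
  rw [Finset.sum_comm]
  have h : ∀ x ∈ C, 3 * ∑ f : Dual 𝔽 V, ∑ y ∈ C, ∑ z ∈ C, (if f x + f y + f z = 0 then 1 else 0) =
      (#C ^ 2 + 2) * Fintype.card (Dual 𝔽 V) := by
    intro x hx
    rw [Finset.sum_comm]
    have h2 : ∀ y ∈ C, 3 * ∑ f : Dual 𝔽 V, ∑ z ∈ C, (if f x + f y + f z = 0 then 1 else 0) =
      (#C + if y = x then 2 else 0) * Fintype.card (Dual 𝔽 V) := by
      intro y hy
      rw [Finset.sum_comm]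
      have h3 : ∀ z ∈ C, 3 * ∑ f : Dual 𝔽 V, (if f x + f y + f z = 0 then 1 else 0) =
        (1 + if y = x then (if z = x then 2 else 0) else 0) * Fintype.card (Dual 𝔽 V) := by
        intro z hz
        simp_rw [← map_add]
        rw [← Finset.card_filter]
        -- All functionals vanish at 0 and one third at any other point; sum 0 forces x = y = z
        -- here.
        by_cases h0 : x + y + z = 0
        · obtain ⟨h1, h2⟩ := (hC.sum_eq_zero_iff hx hy hz).1 h0
          rw [h0]
          simp [h1, h2, Finset.card_univ]
        · rw [card_dual_apply_eq_zero h0]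
          have : ¬ (y = x ∧ z = x) := fun h => h0 ((hC.sum_eq_zero_iff hx hy hz).2 h)
          by_cases hyx : y = x <;> simp_all
      rw [Finset.mul_sum, Finset.sum_congr rfl h3, ← Finset.sum_mul, Finset.sum_add_distrib]
      by_cases hyx : y = x <;> simp [hyx, hx]
    rw [Finset.mul_sum, Finset.sum_congr rfl h2, ← Finset.sum_mul, Finset.sum_add_distrib]
    simp [hx, sq]
  rw [Finset.mul_sum, Finset.sum_congr rfl h, Finset.sum_const, smul_eq_mul]
  ring

theorem sum_dual_pairs (C : Finset V) :
    3 * ∑ f : Dual 𝔽 V, ∑ x ∈ C, ∑ y ∈ C, (if f x - f y = 0 then 1 else 0) =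
      (#C ^ 2 + 2 * #C) * 3 ^ finrank 𝔽 V := by
  classical
  rw [← card_dual (V := V), Finset.sum_comm]
  have h : ∀ x ∈ C, 3 * ∑ f : Dual 𝔽 V, ∑ y ∈ C, (if f x - f y = 0 then 1 else 0) =
      (#C + 2) * Fintype.card (Dual 𝔽 V) := by
    intro x hx
    rw [Finset.sum_comm]
    have h2 : ∀ y ∈ C, 3 * ∑ f : Dual 𝔽 V, (if f x - f y = 0 then 1 else 0) =
        (1 + if y = x then 2 else 0) * Fintype.card (Dual 𝔽 V) := by
      intro y hy
      simp_rw [← map_sub]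
      rw [← Finset.card_filter]
      by_cases h0 : y = x
      · simp [h0, Finset.card_univ]
      · rw [card_dual_apply_eq_zero (sub_ne_zero.2 (Ne.symm h0))]
        simp [h0]
    rw [Finset.mul_sum, Finset.sum_congr rfl h2, ← Finset.sum_mul, Finset.sum_add_distrib]
    simp [hx]
  rw [Finset.mul_sum, Finset.sum_congr rfl h, Finset.sum_const, smul_eq_mul]
  ring

/-- Some nonzero functional has at most average `∑ n_c ^ 3 + 6 n_0 n_1 n_2 + k * ∑ n_c ^ 2`, where
`n_c` are the sizes of its fibres on a cap. -/
theorem LineFree.exists_dual_le {C : Finset V} (hC : LineFree C) (k M : ℕ)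
    (hM : (#C ^ 3 + 2 * #C) * 3 ^ finrank 𝔽 V + k * ((#C ^ 2 + 2 * #C) * 3 ^ finrank 𝔽 V) <
      3 * ((M + 1) * (3 ^ finrank 𝔽 V - 1) + (#C ^ 3 + k * #C ^ 2))) :
    ∃ f : Dual 𝔽 V, f ≠ 0 ∧ ∃ a b c : ℕ, #{x ∈ C | f x = 0} = a ∧ #{x ∈ C | f x = 1} = b ∧
      #{x ∈ C | f x = 2} = c ∧ a + b + c = #C ∧
      a ^ 3 + b ^ 3 + c ^ 3 + 6 * a * b * c + k * (a ^ 2 + b ^ 2 + c ^ 2) ≤ M := by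
  classical
  by_contra! h
  set w : Dual 𝔽 V → ℕ := fun f =>
    (∑ x ∈ C, ∑ y ∈ C, ∑ z ∈ C, (if f x + f y + f z = 0 then 1 else 0)) +
    k * ∑ x ∈ C, ∑ y ∈ C, (if f x - f y = 0 then 1 else 0) with hw
  have h1 : 3 * ∑ f, w f =
      (#C ^ 3 + 2 * #C) * 3 ^ finrank 𝔽 V + k * ((#C ^ 2 + 2 * #C) * 3 ^ finrank 𝔽 V) := by
    rw [← hC.sum_dual_triples, ← sum_dual_pairs, hw, Finset.sum_add_distrib, ← Finset.mul_sum]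
    ring
  have h2 : ∑ f, w f = w 0 + ∑ f ∈ univ.erase 0, w f := (Finset.add_sum_erase _ _ (mem_univ _)).symm
  -- The zero functional has a single nontrivial fibre; its weight is removed before averaging.
  have h3 : w 0 = #C ^ 3 + k * #C ^ 2 := by
    simp [hw]; ring
  have h4 : #(univ.erase (0 : Dual 𝔽 V)) * (M + 1) ≤ ∑ f ∈ univ.erase 0, w f := by
    rw [← smul_eq_mul]
    refine Finset.card_nsmul_le_sum _ _ _ fun f hf => ?_
    have := h f (Finset.ne_of_mem_erase hf) _ _ _ rfl rfl rfl (card_eq_sum_fibre C f)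
    simp only [hw, sum_add_eq_zero, sum_sub_eq_zero]
    omega
  rw [Finset.card_erase_of_mem (mem_univ _), Finset.card_univ, card_dual] at h4
  rw [← h1, h2, h3] at hM
  nlinarith

end Fourier

/-! ### Affine equivalences -/

section Transport

variable {V V' V'' : Type*} [AddCommGroup V] [Module 𝔽 V] [AddCommGroup V'] [Module 𝔽 V']
  [AddCommGroup V''] [Module 𝔽 V'']

/-- The image of a set of points under an affine equivalence. -/
def transport (e : V ≃ᵃ[𝔽] V') (C : Finset V) : Finset V' := C.map e.toEquiv.toEmbedding

theorem mem_transport {e : V ≃ᵃ[𝔽] V'} {C : Finset V} {x : V'} :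
    x ∈ transport e C ↔ e.symm x ∈ C := by
  simp only [transport, Finset.mem_map_equiv]
  rfl

theorem apply_mem_transport {e : V ≃ᵃ[𝔽] V'} {C : Finset V} {x : V} :
    e x ∈ transport e C ↔ x ∈ C := by
  rw [mem_transport, e.symm_apply_apply]

theorem card_transport (e : V ≃ᵃ[𝔽] V') (C : Finset V) : #(transport e C) = #C :=
  Finset.card_map _

theorem transport_trans (e : V ≃ᵃ[𝔽] V') (e' : V' ≃ᵃ[𝔽] V'') (C : Finset V) :
    transport (e.trans e') C = transport e' (transport e C) := by
  ext x
  simp only [mem_transport]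
  rfl

theorem add_eq_zero_iff (e : V ≃ᵃ[𝔽] V') (x y z : V) :
    e x + e y + e z = 0 ↔ x + y + z = 0 := by
  have h : ∀ v, e v = e.linear v + e 0 := fun v => by
    have := e.map_vadd 0 v
    simpa using this
  rw [h x, h y, h z, show e.linear x + e 0 + (e.linear y + e 0) + (e.linear z + e 0) =
    e.linear (x + y + z) + (e 0 + e 0 + e 0) by rw [map_add, map_add]; abel,
    three_nsmul_eq_zero, add_zero]
  exact e.linear.map_eq_zero_iff

theorem LineFree.map_affineEquiv {C : Finset V} (hC : LineFree C) (e : V ≃ᵃ[𝔽] V') :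
    LineFree (transport e C) := by
  intro x hx y hy z hz h
  rw [mem_transport] at hx hy hz
  rw [← add_eq_zero_iff e.symm] at h
  exact e.symm.injective (hC _ hx _ hy _ hz h)

/-- An isomorphism from the kernel of `f` to `W`, extended to `V`, completes `f` to coordinates: the
two maps have no common nonzero kernel vector. -/
theorem exists_linearEquiv_fst_eq {W : Type*} [AddCommGroup W] [Module 𝔽 W] [Finite V] [Finite W]
    (hd : finrank 𝔽 V = finrank 𝔽 W + 1) {f : Dual 𝔽 V} (hf : f ≠ 0) :
    ∃ e : V ≃ₗ[𝔽] 𝔽 × W, ∀ x, (e x).1 = f x := by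
  have : Module.Finite 𝔽 V := .of_finite
  have : Module.Finite 𝔽 W := .of_finite
  have hk : finrank 𝔽 (LinearMap.ker f) = finrank 𝔽 W := by
    have h1 := f.finrank_range_add_finrank_ker
    rw [LinearMap.range_eq_top.2 (LinearMap.surjective hf), finrank_top, finrank_self] at h1
    omega
  let i : LinearMap.ker f ≃ₗ[𝔽] W := LinearEquiv.ofFinrankEq _ _ hk
  obtain ⟨g, hg⟩ := LinearMap.exists_extend (i : LinearMap.ker f →ₗ[𝔽] W)
  have hinj : Function.Injective (f.prod g) := by
    rw [← LinearMap.ker_eq_bot, LinearMap.ker_eq_bot']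
    intro x hx
    have h1 : f x = 0 := congrArg Prod.fst hx
    have h2 : g x = 0 := congrArg Prod.snd hx
    have h3 : i ⟨x, h1⟩ = 0 := by
      rw [← h2]
      exact (LinearMap.congr_fun hg ⟨x, h1⟩).symm
    exact congrArg Subtype.val (i.map_eq_zero_iff.1 h3)
  refine ⟨LinearMap.linearEquivOfInjective (f.prod g) hinj ?_, fun x => rfl⟩
  rw [finrank_prod, finrank_self, hd, add_comm]

end Transport

/-! ### Parallel slices, sorting and shears -/

section Slices

variable {W : Type*} [DecidableEq W]

/-- The slice of a set of points of `GF(3) × W` at the first coordinate `c`. -/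
def slice (C : Finset (𝔽 × W)) (c : 𝔽) : Finset W := {x ∈ C | x.1 = c}.image Prod.snd

theorem mem_slice {C : Finset (𝔽 × W)} {c : 𝔽} {w : W} : w ∈ slice C c ↔ (c, w) ∈ C := by
  simp [slice]

theorem card_slice (C : Finset (𝔽 × W)) (c : 𝔽) : #(slice C c) = #{x ∈ C | x.1 = c} := by
  refine Finset.card_image_of_injOn fun x hx y hy h => Prod.ext ?_ h
  rw [Finset.mem_coe, Finset.mem_filter] at hx hy
  rw [hx.2, hy.2]

variable [AddCommGroup W]

theorem lineFree_slice {C : Finset (𝔽 × W)} (hC : LineFree C) (c : 𝔽) : LineFree (slice C c) := by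
  intro x hx y hy z hz h
  rw [mem_slice] at hx hy hz
  have := hC _ hx _ hy _ hz (by simp [h, three_nsmul_eq_zero])
  exact congrArg Prod.snd this

theorem LineFree.slice_add_ne_zero {C : Finset (𝔽 × W)} (hC : LineFree C) {x y z : W}
    (hx : x ∈ slice C 0) (hy : y ∈ slice C 1) (hz : z ∈ slice C 2) : x + y + z ≠ 0 := by
  intro h
  rw [mem_slice] at hx hy hz
  have h0 : (0 : 𝔽) + 1 + 2 = 0 := by decide
  have := hC _ hx _ hy _ hz (Prod.ext h0 h)
  simp at this

variable [Module 𝔽 W]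

/-- All six permutations of GF(3) are affine, so slices may be reordered freely. -/
theorem exists_affineEquiv_perm (σ : Equiv.Perm 𝔽) : ∃ e : 𝔽 ≃ᵃ[𝔽] 𝔽, ∀ t, e t = σ t := by
  obtain ⟨a, b, ha, h⟩ : ∃ a b : 𝔽, a ≠ 0 ∧ ∀ t, b + a * t = σ t := by
    revert σ; decide
  exact ⟨(LinearEquiv.smulOfNeZero 𝔽 𝔽 a ha).toAffineEquiv.trans (AffineEquiv.constVAdd 𝔽 𝔽 b), h⟩

theorem exists_perm_sorted (n : 𝔽 → ℕ) :
    ∃ σ : Equiv.Perm 𝔽, n (σ 0) ≤ n (σ 1) ∧ n (σ 1) ≤ n (σ 2) :=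
  have h := Tuple.monotone_sort (n := 3) n
  ⟨Tuple.sort (n := 3) n, h (show (0 : Fin 3) ≤ 1 by decide), h (show (1 : Fin 3) ≤ 2 by decide)⟩

theorem LineFree.exists_sorted_slices [Finite W] {C : Finset (𝔽 × W)} (hC : LineFree C)
    {d : ℕ} (hd : finrank 𝔽 W = d) (k M : ℕ)
    (hM : (#C ^ 3 + 2 * #C) * 3 ^ (d + 1) + k * ((#C ^ 2 + 2 * #C) * 3 ^ (d + 1)) <
      3 * ((M + 1) * (3 ^ (d + 1) - 1) + (#C ^ 3 + k * #C ^ 2))) :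
    ∃ e : (𝔽 × W) ≃ᵃ[𝔽] 𝔽 × W, ∃ a b c : ℕ, #(slice (transport e C) 0) = a ∧
      #(slice (transport e C) 1) = b ∧ #(slice (transport e C) 2) = c ∧ a ≤ b ∧ b ≤ c ∧
      a + b + c = #C ∧ a ^ 3 + b ^ 3 + c ^ 3 + 6 * a * b * c + k * (a ^ 2 + b ^ 2 + c ^ 2) ≤ M := by
  have : Module.Finite 𝔽 W := .of_finite
  have hd' : finrank 𝔽 (𝔽 × W) = finrank 𝔽 W + 1 := by
    rw [finrank_prod, finrank_self, add_comm]
  rw [← hd, ← hd'] at hM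
  obtain ⟨f, hf, a, b, c, ha, hb, hc, hs, hle⟩ := hC.exists_dual_le k M hM
  obtain ⟨L, hL⟩ := exists_linearEquiv_fst_eq hd' hf
  subst ha hb hc
  let n : 𝔽 → ℕ := fun i => #{x ∈ C | f x = i}
  obtain ⟨σ, h01, h12⟩ := exists_perm_sorted n
  obtain ⟨g, hg⟩ := exists_affineEquiv_perm σ.symm
  let e := L.toAffineEquiv.trans (g.prodCongr (AffineEquiv.refl 𝔽 W))
  have he : ∀ x, (e x).1 = σ.symm (f x) := by
    intro x
    rw [← hL, ← hg]
    rfl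
  have hcard : ∀ i : 𝔽, #(slice (transport e C) i) = n (σ i) := by
    intro i
    rw [card_slice, transport, Finset.filter_map, Finset.card_map]
    congr 1
    ext x
    simp only [mem_filter, Function.comp]
    refine and_congr_right fun _ => ?_
    change (e x).1 = i ↔ _
    rw [he, Equiv.symm_apply_eq]
  have hs1 := Equiv.sum_comp σ n
  have hs2 := Equiv.sum_comp σ fun i => n i ^ 2
  have hs3 := Equiv.sum_comp σ fun i => n i ^ 3
  have hp := Equiv.prod_comp σ n
  rw [sum_zmod_three, sum_zmod_three] at hs1 hs2 hs3
  rw [prod_zmod_three, prod_zmod_three] at hp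
  refine ⟨e, _, _, _, hcard 0, hcard 1, hcard 2, h01, h12, hs1.trans hs, ?_⟩
  rw [hs2, hs3, mul_assoc 6, mul_assoc 6, hp]
  rwa [mul_assoc 6, mul_assoc 6] at hle

/-- The map (t, w) ↦ (t, w + t s + r) translates slice t by r + t s, so any two slices can be moved
independently. -/
theorem exists_shear (r s : W) : ∃ e : (𝔽 × W) ≃ᵃ[𝔽] 𝔽 × W, ∀ C t,
    #(slice (transport e C) t) = #(slice C t) ∧
    ∀ w, w ∈ slice (transport e C) t ↔ w - t • s - r ∈ slice C t := by
  let L : (𝔽 × W) ≃ₗ[𝔽] 𝔽 × W := LinearEquiv.skewProd (LinearEquiv.refl 𝔽 𝔽)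
    (LinearEquiv.refl 𝔽 W) (LinearMap.toSpanSingleton 𝔽 W s)
  let e := L.toAffineEquiv.trans (AffineEquiv.constVAdd 𝔽 (𝔽 × W) (0, r))
  have he : ∀ t w, e (t, w) = (t, r + (w + t • s)) := by
    intro t w
    change ((0 : 𝔽), r) + (t, w + t • s) = _
    simp
  have hmem : ∀ C t w, w ∈ slice (transport e C) t ↔ w - t • s - r ∈ slice C t := by
    intro C t w
    rw [mem_slice, mem_slice, ← apply_mem_transport (e := e) (C := C), he,
      show r + (w - t • s - r + t • s) = w by abel]
  refine ⟨e, fun C t => ⟨?_, hmem C t⟩⟩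
  exact Finset.card_equiv ((Equiv.subRight (t • s)).trans (Equiv.subRight r)) fun w => hmem C t w

theorem exists_prod_affineEquiv (g : W ≃ᵃ[𝔽] W) : ∃ e : (𝔽 × W) ≃ᵃ[𝔽] 𝔽 × W, ∀ C t,
    slice (transport e C) t = transport g (slice C t) := by
  refine ⟨(AffineEquiv.refl 𝔽 𝔽).prodCongr g, fun C t => ?_⟩
  ext w
  rw [mem_slice, mem_transport, mem_transport, mem_slice]
  rfl

end Slices

/-! ### Largest caps in dimensions 2 and 3 -/

section Classification

theorem LineFree.card_le_two {C : Finset 𝔽} (hC : LineFree C) : #C ≤ 2 := by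
  revert hC
  unfold LineFree
  revert C
  decide

theorem finrank_prod_two : finrank 𝔽 (𝔽 × 𝔽) = 2 := by simp

theorem finrank_prod_three : finrank 𝔽 (𝔽 × 𝔽 × 𝔽) = 3 := by simp

theorem LineFree.card_le_four {C : Finset (𝔽 × 𝔽)} (hC : LineFree C) : #C ≤ 4 := by
  by_contra! h
  obtain ⟨D, hDC, hD⟩ := Finset.exists_subset_card_eq (n := 5) h
  -- 35 is the average weight over nonzero functionals; the only split with parts at most 2, namely
  -- 1+2+2, weighs 41. The later bounds are likewise averages, rounded down.
  obtain ⟨e, a, b, c, -, -, hc, hab, hbc, hs, hle⟩ :=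
    (hC.mono hDC).exists_sorted_slices (finrank_self 𝔽) 0 35 (by norm_num [hD])
  have hc2 : c ≤ 2 := hc ▸ (lineFree_slice ((hC.mono hDC).map_affineEquiv e) 2).card_le_two
  rw [hD] at hs
  interval_cases c <;> interval_cases b <;> omega

/-- A cap of four points in `AG(2,3)`. -/
def square : Finset (𝔽 × 𝔽) := {x | x.1 ≠ 0 ∧ x.2 ≠ 0}

theorem exists_eq_compl_of_card_eq_two {C : Finset 𝔽} (hC : #C = 2) :
    ∃ m, ∀ t, t ∈ C ↔ t - m ≠ 0 := by
  revert C; decide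

theorem LineFree.exists_transport_eq_square {C : Finset (𝔽 × 𝔽)} (hC : LineFree C)
    (h : #C = 4) : ∃ e : (𝔽 × 𝔽) ≃ᵃ[𝔽] 𝔽 × 𝔽, transport e C = square := by
  obtain ⟨e, a, b, c, ha, hb, hc, hab, hbc, hs, hle⟩ :=
    hC.exists_sorted_slices (finrank_self 𝔽) 0 19 (by norm_num [h])
  have hc2 : c ≤ 2 := hc ▸ (lineFree_slice (hC.map_affineEquiv e) 2).card_le_two
  obtain ⟨rfl, rfl, rfl⟩ : a = 0 ∧ b = 2 ∧ c = 2 := by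
    rw [h] at hs
    interval_cases c <;> interval_cases b <;> omega
  obtain ⟨m, hm⟩ := exists_eq_compl_of_card_eq_two hb
  obtain ⟨m', hm'⟩ := exists_eq_compl_of_card_eq_two hc
  -- Solves r + s = -m and r + 2s = -m', moving both missing points to 0.
  obtain ⟨g, hg⟩ := exists_shear (m' - 2 * m) (m - m')
  refine ⟨e.trans g, ?_⟩
  rw [transport_trans]
  ext ⟨t, w⟩
  rw [← mem_slice, (hg _ _).2]
  have ht : t = 0 ∨ t = 1 ∨ t = 2 := by revert t; decide
  rcases ht with rfl | rfl | rfl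
  · rw [Finset.card_eq_zero.1 ha]
    simp [square]
  · rw [hm]
    simp only [square, mem_filter, mem_univ, true_and, smul_eq_mul]
    clear hg hm hm'
    revert w m m'; decide
  · rw [hm']
    simp only [square, mem_filter, mem_univ, true_and, smul_eq_mul]
    clear hg hm hm'
    revert w m m'; decide

theorem LineFree.card_le_nine {C : Finset (𝔽 × 𝔽 × 𝔽)} (hC : LineFree C) : #C ≤ 9 := by
  by_contra! h
  obtain ⟨D, hDC, hD⟩ := Finset.exists_subset_card_eq (n := 10) h
  obtain ⟨e, a, b, c, -, -, hc, hab, hbc, hs, hle⟩ :=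
    (hC.mono hDC).exists_sorted_slices finrank_prod_two 0 314 (by norm_num [hD])
  have hc2 : c ≤ 4 := hc ▸ (lineFree_slice ((hC.mono hDC).map_affineEquiv e) 2).card_le_four
  rw [hD] at hs
  have hb2 : b ≤ 4 := hbc.trans hc2
  obtain rfl : a = 10 - b - c := by omega
  interval_cases c <;> interval_cases b <;> omega

/-- A cap of nine points in `AG(3,3)`. -/
def paraboloid : Finset (𝔽 × 𝔽 × 𝔽) := {x | x.1 = x.2.1 ^ 2 + x.2.2 ^ 2}

/-- Outside the square lie two lines crossing at 0; four of these five points including 0 would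
contain a whole line. -/
theorem LineFree.eq_axes {A : Finset (𝔽 × 𝔽)} (hA : LineFree A) (h : #A = 4)
    (hsq : ∀ a ∈ A, a ∉ square) : ∀ w, w ∈ A ↔ 1 = w.1 ^ 2 + w.2 ^ 2 := by
  have hsub : A ∈ powersetCard 4 ({(0, 0), (0, 1), (0, 2), (1, 0), (2, 0)} : Finset (𝔽 × 𝔽)) := by
    rw [mem_powersetCard]
    refine ⟨fun a ha => ?_, h⟩
    have := hsq a ha
    clear hsq ha
    revert a; decide
  have key : ∀ A ∈ powersetCard 4 ({(0, 0), (0, 1), (0, 2), (1, 0), (2, 0)} : Finset (𝔽 × 𝔽)),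
      (∀ x ∈ A, ∀ y ∈ A, ∀ z ∈ A, x + y + z = 0 → x = y) →
      ∀ w, w ∈ A ↔ 1 = w.1 ^ 2 + w.2 ^ 2 := by
    decide
  exact key A hsub hA

theorem LineFree.exists_transport_eq_paraboloid {C : Finset (𝔽 × 𝔽 × 𝔽)} (hC : LineFree C)
    (h : #C = 9) : ∃ e : (𝔽 × 𝔽 × 𝔽) ≃ᵃ[𝔽] 𝔽 × 𝔽 × 𝔽, transport e C = paraboloid := by
  obtain ⟨e, a, b, c, ha, hb, hc, hab, hbc, hs, hle⟩ :=
    hC.exists_sorted_slices finrank_prod_two 0 230 (by norm_num [h])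
  have hC1 := hC.map_affineEquiv e
  have hc2 : c ≤ 4 := hc ▸ (lineFree_slice hC1 2).card_le_four
  obtain ⟨rfl, rfl, rfl⟩ : a = 1 ∧ b = 4 ∧ c = 4 := by
    have hb2 : b ≤ 4 := hbc.trans hc2
    rw [h] at hs
    obtain rfl : a = 9 - b - c := by omega
    interval_cases c <;> interval_cases b <;> omega
  obtain ⟨g, hg⟩ := (lineFree_slice hC1 2).exists_transport_eq_square hc
  obtain ⟨e', he'⟩ := exists_prod_affineEquiv g
  have hC2 := hC1.map_affineEquiv e'
  obtain ⟨p, hp⟩ : ∃ p, slice (transport e' (transport e C)) 0 = {p} := by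
    rw [← Finset.card_eq_one, he', card_transport, ha]
  have hsq : slice (transport e' (transport e C)) 2 = square := by rw [he', hg]
  -- Slice 0 moves by -p to the origin, while slice 2 moves by -3p = 0.
  obtain ⟨s, hs⟩ := exists_shear (-p) (-p)
  have hC3 := hC2.map_affineEquiv s
  set D := transport s (transport e' (transport e C)) with hD
  have h0 : ∀ w, w ∈ slice D 0 ↔ w = 0 := by
    intro w
    rw [(hs _ _).2, hp, mem_singleton]
    simp
  have h2 : slice D 2 = square := by
    ext w
    rw [(hs _ _).2, hsq, two_smul, show w - (-p + -p) - -p = w + (p + p + p) by abel,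
      three_nsmul_eq_zero, add_zero]
  have h1 : ∀ w, w ∈ slice D 1 ↔ 1 = w.1 ^ 2 + w.2 ^ 2 := by
    refine (lineFree_slice hC3 1).eq_axes ?_ fun a ha ha2 => ?_
    · rw [(hs _ _).1, he', card_transport, hb]
    · refine hC3.slice_add_ne_zero ((h0 0).2 rfl) ha (z := -a) ?_ (by abel)
      rw [h2]
      revert ha2
      clear ha
      revert a; decide
  refine ⟨(e.trans e').trans s, ?_⟩
  rw [transport_trans, transport_trans, ← hD]
  ext ⟨t, w⟩
  rw [← mem_slice]
  have ht : t = 0 ∨ t = 1 ∨ t = 2 := by revert t; decide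
  rcases ht with rfl | rfl | rfl
  · rw [h0]
    revert w; decide
  · rw [h1]
    simp [paraboloid]
  · rw [h2]
    revert w; decide

/-- The affine map with linear part sending `(0, 1, 0)` to `(u, s, t)` and fixing the paraboloid. -/
def paraboloidMap (u s t : 𝔽) (v : 𝔽 × 𝔽 × 𝔽) : 𝔽 × 𝔽 × 𝔽 :=
  let n := s ^ 2 + t ^ 2
  let p := 2 * u * n * s
  let q := 2 * u * n * t
  (n * v.1 + 2 * (p * (s * v.2.1 - t * v.2.2) + q * (t * v.2.1 + s * v.2.2)) + p ^ 2 + q ^ 2,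
    s * v.2.1 - t * v.2.2 + p, t * v.2.1 + s * v.2.2 + q)

theorem paraboloidMap_injective (u : 𝔽) {s t : 𝔽} (h : s ≠ 0 ∨ t ≠ 0) :
    Function.Injective (paraboloidMap u s t) := by
  intro v w hvw
  have h1 : ∀ s t a b : 𝔽, (s ≠ 0 ∨ t ≠ 0) → s * a - t * b = 0 → t * a + s * b = 0 →
      a = 0 ∧ b = 0 := by decide
  have h2 : ∀ s t c : 𝔽, (s ≠ 0 ∨ t ≠ 0) → (s ^ 2 + t ^ 2) * c = 0 → c = 0 := by decide
  simp only [paraboloidMap, Prod.mk.injEq] at hvw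
  obtain ⟨hz, hx, hy⟩ := hvw
  obtain ⟨hx', hy'⟩ := h1 s t (v.2.1 - w.2.1) (v.2.2 - w.2.2) h (by linear_combination hx)
    (by linear_combination hy)
  rw [sub_eq_zero.1 hx', sub_eq_zero.1 hy'] at hz
  have hz' := h2 s t (v.1 - w.1) h (by linear_combination hz)
  exact Prod.ext (sub_eq_zero.1 hz') (Prod.ext (sub_eq_zero.1 hx') (sub_eq_zero.1 hy'))

/-- On the plane GF(9) the map is multiplication by s + ti followed by translation by p + qi, the
first coordinate following the norm. As n² = 1, the choice of p and q makes the linear part send (0,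
1, 0) to (u, s, t). -/
theorem paraboloidMap_add_mem : ∀ u s t : 𝔽, (s ≠ 0 ∨ t ≠ 0) → ∀ v,
    v + (0, 1, 0) ∈ paraboloid → paraboloidMap u s t v + (u, s, t) ∈ paraboloid := by
  decide +kernel

theorem paraboloidMap_sub_mem : ∀ u s t : 𝔽, (s ≠ 0 ∨ t ≠ 0) → ∀ v,
    v - (0, 1, 0) ∈ paraboloid → paraboloidMap u s t v - (u, s, t) ∈ paraboloid := by
  decide +kernel

theorem paraboloidMap_sum (u s t : 𝔽) {x y z : 𝔽 × 𝔽 × 𝔽} (h : x + y + z = 0) :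
    paraboloidMap u s t x + paraboloidMap u s t y + paraboloidMap u s t z = 0 := by
  obtain rfl : z = - x - y := by linear_combination h
  have h3 : (3 : 𝔽) = 0 := by decide
  simp only [paraboloidMap, Prod.mk_add_mk, Prod.fst_sub, Prod.fst_neg, Prod.snd_sub, Prod.snd_neg]
  ext <;> simp only [Prod.fst_zero, Prod.snd_zero]
  · linear_combination ((2 * u * (s ^ 2 + t ^ 2) * s) ^ 2 + (2 * u * (s ^ 2 + t ^ 2) * t) ^ 2) * h3
  · linear_combination (2 * u * (s ^ 2 + t ^ 2) * s) * h3
  · linear_combination (2 * u * (s ^ 2 + t ^ 2) * t) * h3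

theorem LineFree.card_lt_nine {A : Finset (𝔽 × 𝔽 × 𝔽)} (hA : LineFree A)
    (h : ∀ a ∈ A, a + (0, 1, 0) ∉ paraboloid ∧ a - (0, 1, 0) ∉ paraboloid) : #A < 9 := by
  have hsub : A ⊆ {(0, 0, 0), (0, 0, 1), (0, 0, 2), (0, 1, 1), (0, 1, 2), (0, 2, 1), (0, 2, 2),
      (1, 0, 1), (1, 0, 2), (2, 0, 0), (2, 1, 0), (2, 2, 0)} := by
    intro a ha
    have := h a ha
    clear ha h
    revert a; decide
  let n : 𝔽 × 𝔽 × 𝔽 → ℕ := fun p => if p ∈ A then 1 else 0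
  have hn : ∀ x y z, x + y + z = 0 → x ≠ y → n x + n y + n z ≤ 2 := by
    intro x y z hs hxy
    have : ¬ (x ∈ A ∧ y ∈ A ∧ z ∈ A) := fun hm => hxy (hA x hm.1 y hm.2.1 z hm.2.2 hs)
    simp only [n]
    split_ifs <;> simp_all
  have hcard : #A = n (0, 0, 0) + (n (0, 0, 1) + (n (0, 0, 2) + (n (0, 1, 1) + (n (0, 1, 2) +
      (n (0, 2, 1) + (n (0, 2, 2) + (n (1, 0, 1) + (n (1, 0, 2) + (n (2, 0, 0) + (n (2, 1, 0) +
      n (2, 2, 0))))))))))) := by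
    rw [← Finset.inter_eq_right.2 hsub, Finset.card_eq_sum_ones, ← Finset.sum_ite_mem]
    repeat rw [Finset.sum_insert (by decide)]
    rw [Finset.sum_singleton]
  have h1 := hn (0, 0, 0) (0, 0, 1) (0, 0, 2) (by decide) (by decide)
  have h2 := hn (0, 0, 0) (0, 1, 1) (0, 2, 2) (by decide) (by decide)
  have h3 := hn (0, 0, 0) (0, 1, 2) (0, 2, 1) (by decide) (by decide)
  have h4 := hn (0, 0, 1) (0, 1, 1) (0, 2, 1) (by decide) (by decide)
  have h5 := hn (0, 0, 1) (1, 0, 2) (2, 0, 0) (by decide) (by decide)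
  have h6 := hn (0, 0, 2) (0, 1, 2) (0, 2, 2) (by decide) (by decide)
  have h7 := hn (0, 0, 2) (1, 0, 1) (2, 0, 0) (by decide) (by decide)
  have h8 := hn (0, 1, 1) (1, 0, 2) (2, 2, 0) (by decide) (by decide)
  have h9 := hn (0, 1, 2) (1, 0, 1) (2, 2, 0) (by decide) (by decide)
  have h10 := hn (0, 2, 1) (1, 0, 2) (2, 1, 0) (by decide) (by decide)
  have h11 := hn (0, 2, 2) (1, 0, 1) (2, 1, 0) (by decide) (by decide)
  have h12 := hn (2, 0, 0) (2, 1, 0) (2, 2, 0) (by decide) (by decide)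
  -- Each of the twelve points lies on exactly three of these twelve lines, so 3 · #A ≤ 24.
  omega

theorem LineFree.exists_card_lt_nine {A : Finset (𝔽 × 𝔽 × 𝔽)} (hA : LineFree A) {u s t : 𝔽}
    (hst : s ≠ 0 ∨ t ≠ 0) (h : ∀ a ∈ A, a + (u, s, t) ∉ paraboloid ∧ a - (u, s, t) ∉ paraboloid) :
    #A < 9 := by
  have hinj := paraboloidMap_injective u hst
  have hbij : Function.Bijective (paraboloidMap u s t) :=
    Finite.injective_iff_bijective.1 hinj
  let κ := Equiv.ofBijective _ hbij
  have hmem : ∀ v, v ∈ A.map κ.symm.toEmbedding ↔ paraboloidMap u s t v ∈ A := fun v => by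
    rw [Finset.mem_map_equiv]; rfl
  rw [← Finset.card_map κ.symm.toEmbedding]
  refine LineFree.card_lt_nine (fun x hx y hy z hz hs => ?_) fun a ha => ?_
  · rw [hmem] at hx hy hz
    exact hinj (hA _ hx _ hy _ hz (paraboloidMap_sum u s t hs))
  · rw [hmem] at ha
    exact ⟨fun h1 => (h _ ha).1 (paraboloidMap_add_mem u s t hst a h1),
      fun h1 => (h _ ha).2 (paraboloidMap_sub_mem u s t hst a h1)⟩

end Classification

/-! ### Uniqueness and completeness of the 20-cap -/

section Twenty

/-- A cap of twenty points in `AG(4,3)`: the points over an elliptic quadric of `PG(3,3)`. -/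
def ellipticCap : Finset (𝔽 × 𝔽 × 𝔽 × 𝔽) :=
  {x | x ≠ 0 ∧ x.1 * x.2.1 = x.2.2.1 ^ 2 + x.2.2.2 ^ 2}

theorem exists_eq_add_sub_of_card_eq_two {C : Finset (𝔽 × 𝔽 × 𝔽)} (hC : #C = 2) :
    ∃ m b, b ≠ 0 ∧ C = {m + b, m - b} := by
  obtain ⟨p, q, hpq, rfl⟩ := Finset.card_eq_two.1 hC
  refine ⟨-(p + q), q - p, sub_ne_zero.2 hpq.symm, ?_⟩
  rw [show -(p + q) + (q - p) = p - (p + p + p) by abel,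
    show -(p + q) - (q - p) = q - (q + q + q) by abel, three_nsmul_eq_zero, three_nsmul_eq_zero,
    sub_zero, sub_zero]

/-- A vertical line meets the paraboloid exactly once. -/
theorem mem_paraboloid_of_add_of_sub {v w : 𝔽 × 𝔽 × 𝔽} (hv0 : v.2 = 0) (hv : v ≠ 0)
    (h : w + v ∉ paraboloid) (h' : w - v ∉ paraboloid) : w ∈ paraboloid := by
  have key : ∀ (t : 𝔽) (w : 𝔽 × 𝔽 × 𝔽), t ≠ 0 → w + (t, 0) ∉ paraboloid →
      w - (t, 0) ∉ paraboloid → w ∈ paraboloid := by decide +kernel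
  obtain ⟨t, x⟩ := v
  obtain rfl : x = 0 := hv0
  exact key t w (by rintro rfl; exact hv rfl) h h'

theorem card_paraboloid : #paraboloid = 9 := by decide +kernel

theorem LineFree.exists_transport_eq_ellipticCap {C : Finset (𝔽 × 𝔽 × 𝔽 × 𝔽)} (hC : LineFree C)
    (h : #C = 20) :
    ∃ e : (𝔽 × 𝔽 × 𝔽 × 𝔽) ≃ᵃ[𝔽] 𝔽 × 𝔽 × 𝔽 × 𝔽, transport e C = ellipticCap := by
  -- Triples alone (k = 0) do not exclude 3+8+9. For k = 5 the average is exactly 3331; 2+9+9 weighs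
  -- 3268 and every other split with parts at most 9 at least 3334.
  obtain ⟨e, a, b, c, ha, hb, hc, hab, hbc, hs, hle⟩ :=
    hC.exists_sorted_slices finrank_prod_three 5 3331 (by norm_num [h])
  have hC1 := hC.map_affineEquiv e
  have hc2 : c ≤ 9 := hc ▸ (lineFree_slice hC1 2).card_le_nine
  obtain ⟨rfl, rfl, rfl⟩ : a = 2 ∧ b = 9 ∧ c = 9 := by
    have hb2 : b ≤ 9 := hbc.trans hc2
    rw [h] at hs
    obtain rfl : a = 20 - b - c := by omega
    interval_cases c <;> interval_cases b <;> omega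
  obtain ⟨g, hg⟩ := (lineFree_slice hC1 1).exists_transport_eq_paraboloid hb
  obtain ⟨e', he'⟩ := exists_prod_affineEquiv g
  have hC2 := hC1.map_affineEquiv e'
  obtain ⟨m, v, hv, hmv⟩ := exists_eq_add_sub_of_card_eq_two
    (C := slice (transport e' (transport e C)) 0) (by rw [he', card_transport, ha])
  have hpar : slice (transport e' (transport e C)) 1 = paraboloid := by rw [he', hg]
  -- Centres slice 0 at the origin and leaves slice 1 fixed.
  obtain ⟨s, hs⟩ := exists_shear (-m) m
  have hC3 := hC2.map_affineEquiv s
  set D := transport s (transport e' (transport e C)) with hD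
  have h0 : ∀ w, w ∈ slice D 0 ↔ w = v ∨ w = -v := by
    intro w
    rw [(hs _ _).2, hmv, mem_insert, mem_singleton, zero_smul, sub_zero, sub_neg_eq_add,
      add_comm w, sub_eq_add_neg, add_right_inj, add_right_inj]
  have h1 : slice D 1 = paraboloid := by
    ext w
    rw [(hs _ _).2, hpar, one_smul, sub_neg_eq_add, sub_add_cancel]
  have h2 : #(slice D 2) = 9 := by rw [(hs _ _).1, he', card_transport, hc]
  have hA : ∀ a ∈ slice D 2, -a + v ∉ paraboloid ∧ -a - v ∉ paraboloid := by
    intro a ha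
    rw [← h1]
    exact ⟨fun h => hC3.slice_add_ne_zero ((h0 (-v)).2 (.inr rfl)) h ha (by abel),
      fun h => hC3.slice_add_ne_zero ((h0 v).2 (.inl rfl)) h ha (by abel)⟩
  -- A non-vertical `v` would leave room for at most eight points in slice 2.
  have hv0 : v.2 = 0 := by
    by_contra hne
    have hst : v.2.1 ≠ 0 ∨ v.2.2 ≠ 0 := by
      by_contra! h
      exact hne (Prod.ext h.1 h.2)
    have hlf : LineFree (transport (LinearEquiv.neg 𝔽).toAffineEquiv (slice D 2)) :=
      (lineFree_slice hC3 2).map_affineEquiv _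
    have := hlf.exists_card_lt_nine hst (u := v.1) fun a ha => by
      have := hA (-a) (mem_transport.1 ha)
      rwa [neg_neg] at this
    rw [card_transport] at this
    omega
  have h2' : ∀ w, w ∈ slice D 2 ↔ -w ∈ paraboloid := by
    have hsub : transport (LinearEquiv.neg 𝔽).toAffineEquiv (slice D 2) ⊆ paraboloid := by
      intro a ha
      have := hA (-a) (mem_transport.1 ha)
      rw [neg_neg] at this
      exact mem_paraboloid_of_add_of_sub hv0 hv this.1 this.2
    have heq := Finset.eq_of_subset_of_card_le hsub (by rw [card_transport, h2, card_paraboloid])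
    intro w
    rw [← heq, mem_transport]
    change _ ↔ - -w ∈ _
    rw [neg_neg]
  refine ⟨(e.trans e').trans s, ?_⟩
  rw [transport_trans, transport_trans, ← hD]
  ext ⟨t, w⟩
  rw [← mem_slice]
  have ht : t = 0 ∨ t = 1 ∨ t = 2 := by revert t; decide
  rcases ht with rfl | rfl | rfl
  · rw [h0]
    have key : ∀ v w : 𝔽 × 𝔽 × 𝔽, v ≠ 0 → v.2 = 0 →
        ((w = v ∨ w = -v) ↔ ((0 : 𝔽), w) ∈ ellipticCap) := by decide +kernel
    exact key v w hv hv0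
  · rw [h1]
    revert w; decide +kernel
  · rw [h2']
    revert w; decide +kernel

theorem lineFree_ellipticCap : LineFree ellipticCap := by
  intro x hx y hy z hz h
  obtain rfl : z = -(x + y) := by
    rw [eq_neg_iff_add_eq_zero, ← h]; abel
  have key : ∀ x ∈ ellipticCap, ∀ y ∈ ellipticCap, -(x + y) ∈ ellipticCap → x = y := by
    decide +kernel
  exact key x hx y hy hz

theorem card_ellipticCap : #ellipticCap = 20 := by decide +kernel

/-- Every point outside the elliptic cap lies on one of its secants. -/
theorem LineFree.eq_ellipticCap {C : Finset (𝔽 × 𝔽 × 𝔽 × 𝔽)} (hC : LineFree C)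
    (h : ellipticCap ⊆ C) : C = ellipticCap := by
  refine Finset.Subset.antisymm (fun x hx => ?_) h
  by_contra hne
  have key : ∀ x ∉ ellipticCap, ∃ y ∈ ellipticCap, x ≠ y ∧ -(x + y) ∈ ellipticCap := by
    decide +kernel
  obtain ⟨y, hy, hxy, hz⟩ := key x hne
  exact hxy (hC x hx y (h hy) _ (h hz) (by abel))

end Twenty

/-! ### Five-point sets on the elliptic quadric -/

section Quadric

/-- Representatives of the ten points of the elliptic quadric `wz = x² + y²` of `PG(3,3)`. -/
def quadricPoint : Fin 10 → 𝔽 × 𝔽 × 𝔽 × 𝔽 :=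
  ![(0, 1, 0, 0), (1, 0, 0, 0), (1, 1, 0, 1), (1, 1, 0, 2), (1, 1, 1, 0), (1, 2, 1, 1),
    (1, 2, 1, 2), (1, 1, 2, 0), (1, 2, 2, 1), (1, 2, 2, 2)]

/-- The value at a point of the linear form with given coefficients. -/
def linearForm (c v : 𝔽 × 𝔽 × 𝔽 × 𝔽) : 𝔽 :=
  c.1 * v.1 + c.2.1 * v.2.1 + c.2.2.1 * v.2.2.1 + c.2.2.2 * v.2.2.2

/-- The set of elements of `Fin 10` encoded by the binary digits of a number. -/
def bitSet (n : ℕ) : Finset (Fin 10) := {i | n.testBit i}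

/-- The number of elements of `bitSet n`. -/
def bitCard (n : ℕ) : ℕ :=
  (n.testBit 0).toNat + (n.testBit 1).toNat + (n.testBit 2).toNat + (n.testBit 3).toNat +
  (n.testBit 4).toNat + (n.testBit 5).toNat + (n.testBit 6).toNat + (n.testBit 7).toNat +
  (n.testBit 8).toNat + (n.testBit 9).toNat

/-- The plane sections of the elliptic quadric that have more than one point, encoded by binary
digits. -/
def circles : List ℕ :=
  [15, 54, 90, 108, 113, 147, 156, 169, 197, 226, 281, 293, 298, 323, 340,
    390, 432, 456, 533, 547, 568, 582, 585, 650, 676, 720, 780, 786, 864, 897]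

/-- Whether a number encodes five points of the elliptic quadric no four of which are coplanar. -/
def isQuintet (n : ℕ) : Bool := bitCard n == 5 && circles.all fun m => m &&& n != m

/-- The sets of five points of the elliptic quadric no four of which are coplanar. -/
def quintets : Finset (Finset (Fin 10)) := {n ∈ range 1024 | isQuintet n}.image bitSet

theorem card_bitSet (n : ℕ) : #(bitSet n) = bitCard n := by
  have h : ∀ b : Bool, (if b = true then 1 else 0) = b.toNat := by decide
  simp only [bitSet, Finset.card_filter, h, Fin.sum_univ_castSucc, Fin.sum_univ_zero, zero_add]
  rfl

theorem bitSet_subset_iff {m n : ℕ} (hm : m < 1024) : bitSet m ⊆ bitSet n ↔ m &&& n = m := by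
  constructor
  · intro h
    refine Nat.eq_of_testBit_eq fun i => ?_
    rw [Nat.testBit_and]
    rcases lt_or_ge i 10 with hi | hi
    · have := @h ⟨i, hi⟩
      simp only [bitSet, mem_filter, mem_univ, true_and] at this
      cases hmi : m.testBit i <;> simp_all
    · rw [Nat.testBit_lt_two_pow (hm.trans_le (Nat.pow_le_pow_right (n := 2) (by norm_num) hi)),
        Bool.false_and]
  · intro h i hi
    rw [← h] at hi
    simp only [bitSet, mem_filter, mem_univ, true_and, Nat.testBit_and, Bool.and_eq_true] at hi ⊢
    exact hi.2

theorem bitSet_injOn : Set.InjOn bitSet (range 1024) := by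
  intro m hm n hn h
  rw [Finset.mem_coe, Finset.mem_range] at hm hn
  have h1 := (bitSet_subset_iff hm).1 h.subset
  have h2 := (bitSet_subset_iff hn).1 h.superset
  rw [← h1, Nat.and_comm, h2]

theorem exists_bitSet_eq (I : Finset (Fin 10)) : ∃ n < 1024, bitSet n = I := by
  have h : (range 1024).image bitSet = univ := by
    rw [← Finset.card_eq_iff_eq_univ, Finset.card_image_of_injOn bitSet_injOn]
    simp
  have := h ▸ Finset.mem_univ I
  simpa using this

theorem compl_bitSet {n : ℕ} : (bitSet n)ᶜ = bitSet (1023 ^^^ n) := by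
  ext i
  have h : Nat.testBit 1023 i = true := by revert i; decide
  simp [bitSet, h]

theorem bitSet_mem_quintets {n : ℕ} (hn : n < 1024) : bitSet n ∈ quintets ↔ isQuintet n := by
  simp only [quintets, mem_image, mem_filter]
  constructor
  · rintro ⟨m, ⟨hm, hq⟩, h⟩
    rwa [← bitSet_injOn hm (Finset.mem_range.2 hn) h]
  · exact fun h => ⟨n, ⟨Finset.mem_range.2 hn, h⟩, rfl⟩

/-- A plane section has at most three points or is a circle of four, so four coplanar points fill a
section. -/
theorem mem_circles_iff {n : ℕ} (hn : n < 1024) (h4 : #(bitSet n) = 4) :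
    n ∈ circles ↔ ∃ c ≠ 0, ∀ i ∈ bitSet n, linearForm c (quadricPoint i) = 0 := by
  constructor
  · have key : ∀ n ∈ circles, ∃ c ≠ 0, ∀ i : Fin 10, n.testBit i →
      linearForm c (quadricPoint i) = 0 := by decide +kernel
    intro h
    simpa [bitSet] using key n h
  · rintro ⟨c, hc, h⟩
    have key : ∀ c ≠ 0, #{i | linearForm c (quadricPoint i) = 0} ≤ 3 ∨
        ∃ m ∈ circles, ∀ i : Fin 10, linearForm c (quadricPoint i) = 0 ↔ m.testBit i := by
      decide +kernel
    have hcirc : ∀ m ∈ circles, m < 1024 ∧ bitCard m = 4 := by decide +kernel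
    obtain h3 | ⟨m, hm, hmem⟩ := key c hc
    · have : bitSet n ⊆ ({i | linearForm c (quadricPoint i) = 0} : Finset (Fin 10)) :=
        fun i hi => by simpa using h i hi
      have := Finset.card_le_card this
      omega
    · have hsub : bitSet n ⊆ bitSet m := fun i hi => by simpa [bitSet] using (hmem i).1 (h i hi)
      have := Finset.eq_of_subset_of_card_le hsub (by rw [card_bitSet, (hcirc m hm).2, h4])
      rwa [bitSet_injOn (Finset.mem_coe.2 (Finset.mem_range.2 hn))
        (Finset.mem_coe.2 (Finset.mem_range.2 (hcirc m hm).1)) this]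

theorem mem_quintets_iff {I : Finset (Fin 10)} : I ∈ quintets ↔ #I = 5 ∧
    ∀ B ⊆ I, #B = 4 → ∀ c, (∀ i ∈ B, linearForm c (quadricPoint i) = 0) → c = 0 := by
  have hcirc : ∀ m ∈ circles, m < 1024 ∧ bitCard m = 4 := by decide +kernel
  obtain ⟨n, hn, rfl⟩ := exists_bitSet_eq I
  rw [bitSet_mem_quintets hn, card_bitSet, isQuintet, Bool.and_eq_true, beq_iff_eq, List.all_eq_true]
  refine and_congr_right fun _ => ⟨fun h B hBI hB c hc => ?_, fun h m hm => ?_⟩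
  · obtain ⟨m, hm, rfl⟩ := exists_bitSet_eq B
    by_contra hc0
    have := h m ((mem_circles_iff hm hB).2 ⟨c, hc0, hc⟩)
    rw [bne_iff_ne] at this
    exact this ((bitSet_subset_iff hm).1 hBI)
  · rw [bne_iff_ne]
    intro hmn
    have h4 := (card_bitSet m).trans (hcirc m hm).2
    obtain ⟨c, hc0, hc⟩ := (mem_circles_iff (hcirc m hm).1 h4).1 hm
    exact hc0 (h _ ((bitSet_subset_iff (hcirc m hm).1).2 hmn) h4 c hc)

/-- In S(3,4,10) the number of blocks missing a 5-set is 30 - 5·12 + 10·4 - 10·1 plus the number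
inside it, and the constant part is 0. -/
theorem compl_mem_quintets {I : Finset (Fin 10)} (hI : I ∈ quintets) : Iᶜ ∈ quintets := by
  have key : ∀ n < 1024, isQuintet n → isQuintet (1023 ^^^ n) := by decide +kernel
  obtain ⟨n, hn, rfl⟩ := exists_bitSet_eq I
  rw [bitSet_mem_quintets hn] at hI
  rw [compl_bitSet, bitSet_mem_quintets (Nat.xor_lt_two_pow (n := 10) (by norm_num) hn)]
  exact key n hn hI

theorem card_quintets_zero_mem : #{I ∈ quintets | 0 ∈ I} = 36 := by
  have key : #{n ∈ range 1024 | isQuintet n ∧ n.testBit 0} = 36 := by decide +kernel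
  rw [← key, quintets, Finset.filter_image, Finset.card_image_of_injOn, Finset.filter_filter]
  · simp [bitSet]
  · exact bitSet_injOn.mono fun n hn => by
      simp only [coe_filter, mem_filter] at hn
      exact hn.1.1

/-- The points of the cap over a set of points of the elliptic quadric. -/
def pointsOver (I : Finset (Fin 10)) : Finset (𝔽 × 𝔽 × 𝔽 × 𝔽) :=
  I.image quadricPoint ∪ I.image fun i => -quadricPoint i

theorem mem_ellipticCap_iff :
    ∀ x, x ∈ ellipticCap ↔ ∃ i, x = quadricPoint i ∨ x = -quadricPoint i := by
  decide +kernel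

theorem quadricPoint_injective : ∀ i j,
    quadricPoint i = quadricPoint j ∨ quadricPoint i = -quadricPoint j → i = j := by
  decide +kernel

theorem quadricPoint_ne_neg : ∀ i, quadricPoint i ≠ -quadricPoint i := by
  decide +kernel

/-- The centre of the cap is the only point on more than three of its secants. -/
theorem card_secants_le {a : 𝔽 × 𝔽 × 𝔽 × 𝔽} (ha : a ≠ 0) :
    #{x ∈ ellipticCap | -(a + x) ∈ ellipticCap} ≤ 9 := by
  -- Dropping the two nonvanishing conditions only enlarges the set, and the bound survives.
  have key : ∀ a : 𝔽 × 𝔽 × 𝔽 × 𝔽, a ≠ 0 →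
      #{x : 𝔽 × 𝔽 × 𝔽 × 𝔽 | (x.1 * x.2.1 = x.2.2.1 ^ 2 + x.2.2.2 ^ 2) ∧
        (a.1 + x.1) * (a.2.1 + x.2.1) = (a.2.2.1 + x.2.2.1) ^ 2 + (a.2.2.2 + x.2.2.2) ^ 2} ≤ 9 := by
    decide +kernel
  refine le_trans (Finset.card_le_card fun x hx => ?_) (key a ha)
  simp only [ellipticCap, mem_filter, mem_univ, true_and] at hx ⊢
  obtain ⟨⟨-, h1⟩, -, h2⟩ := hx
  change -(a.1 + x.1) * -(a.2.1 + x.2.1) = (-(a.2.2.1 + x.2.2.1)) ^ 2 +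
    (-(a.2.2.2 + x.2.2.2)) ^ 2 at h2
  rw [neg_mul_neg, neg_sq, neg_sq] at h2
  exact ⟨h1, h2⟩

end Quadric

/-! ### Lines and hyperplanes in coordinates -/

section Geometry

theorem exists_isLine {x y : AG43} (hxy : x ≠ y) :
    ∃ L : AffineSubspace 𝔽 AG43, IsLine L ∧ (L : Set AG43) = {x, y, -(x + y)} := by
  refine ⟨AffineSubspace.mk' x (𝔽 ∙ (y - x)), ?_, ?_⟩
  · rw [IsLine, AffineSubspace.direction_mk', finrank_span_singleton (sub_ne_zero.2 hxy.symm)]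
  · ext p
    rw [SetLike.mem_coe, AffineSubspace.mem_mk', Submodule.mem_span_singleton, vsub_eq_sub]
    simp only [Set.mem_insert_iff, Set.mem_singleton_iff]
    have h3 := three_nsmul_eq_zero x
    constructor
    · rintro ⟨t, ht⟩
      have h : ∀ t : 𝔽, t = 0 ∨ t = 1 ∨ t = 2 := by decide
      rw [eq_sub_iff_add_eq] at ht
      subst ht
      rcases h t with rfl | rfl | rfl
      · simp
      · simp
      · right; right
        rw [two_smul, ← sub_eq_zero, show y - x + (y - x) + x - -(x + y) = y + y + y by abel]
        exact three_nsmul_eq_zero y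
    · rintro (rfl | rfl | rfl)
      · exact ⟨0, by simp⟩
      · exact ⟨1, by simp⟩
      · refine ⟨2, ?_⟩
        rw [two_smul, ← sub_eq_zero, show y - x + (y - x) - (-(x + y) - x) = y + y + y by abel]
        exact three_nsmul_eq_zero y

theorem IsLine.exists_add_mem_sub_mem {L : AffineSubspace 𝔽 AG43} (hL : IsLine L) :
    ∃ v ≠ 0, ∀ x ∈ L, x + v ∈ L ∧ x - v ∈ L := by
  have : Nontrivial L.direction := by
    rw [← Module.finrank_pos_iff (R := 𝔽), hL]; exact one_pos
  obtain ⟨v, hv⟩ := exists_ne (0 : L.direction)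
  refine ⟨v, fun h => hv (Subtype.ext h), fun x hx => ⟨?_, ?_⟩⟩
  · rw [add_comm]
    exact AffineSubspace.vadd_mem_of_mem_direction v.2 hx
  · rw [sub_eq_neg_add]
    exact AffineSubspace.vadd_mem_of_mem_direction (neg_mem v.2) hx

theorem IsLine.nonempty {L : AffineSubspace 𝔽 AG43} (hL : IsLine L) : ∃ x, x ∈ L := by
  by_contra! h
  have : L = ⊥ := (AffineSubspace.coe_eq_bot_iff L).1 (Set.eq_empty_iff_forall_notMem.2 h)
  rw [IsLine, this, AffineSubspace.direction_bot, finrank_bot] at hL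
  exact absurd hL (by norm_num)

theorem isCap_iff_lineFree {C : Finset AG43} : IsCap C ↔ LineFree C := by
  constructor
  · intro hC x hx y hy z hz h
    by_contra hxy
    obtain ⟨L, hL, hLC⟩ := exists_isLine hxy
    refine hC L hL ?_
    rw [hLC, ← eq_neg_of_add_eq_zero_right h]
    rintro p (rfl | rfl | rfl)
    exacts [hx, hy, hz]
  · intro hC L hL hLC
    obtain ⟨x, hx⟩ := hL.nonempty
    obtain ⟨v, hv, h⟩ := hL.exists_add_mem_sub_mem
    have := hC x (hLC hx) (x + v) (hLC (h x hx).1) (x - v) (hLC (h x hx).2)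
      (by rw [show x + (x + v) + (x - v) = x + x + x by abel, three_nsmul_eq_zero])
    exact hv (by simpa using this)

theorem isALine_iff {a b c : AG43} : IsALine a b c ↔ a ≠ b ∧ a + b + c = 0 := by
  constructor
  · rintro ⟨L, hL, hLC⟩
    obtain ⟨v, hv, h⟩ := hL.exists_add_mem_sub_mem
    have ha : a ∈ L := by rw [← SetLike.mem_coe, hLC]; simp
    obtain ⟨h1, h2⟩ := h a ha
    rw [← SetLike.mem_coe, hLC] at h1 h2
    have h3 := three_nsmul_eq_zero a
    -- The points a + v and a - v are then distinct, so they are b and c in some order.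
    have hvv : v ≠ -v := by
      intro h
      have := three_nsmul_eq_zero v
      rw [eq_neg_iff_add_eq_zero.1 h, zero_add] at this
      exact hv this
    simp only [Set.mem_insert_iff, Set.mem_singleton_iff, add_eq_left, sub_eq_self, hv,
      false_or] at h1 h2
    have hne : a - v ≠ a + v := by
      rw [sub_eq_add_neg, Ne, add_right_inj]
      exact hvv.symm
    rcases h1 with rfl | rfl <;> rcases h2 with h2 | h2
    · exact absurd h2 hne
    · subst h2
      refine ⟨by simpa using hv, ?_⟩
      rw [← h3]; abel
    · subst h2
      refine ⟨by simpa [sub_eq_add_neg] using hv, ?_⟩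
      rw [← h3]; abel
    · exact absurd h2 hne
  · rintro ⟨hab, h⟩
    obtain ⟨L, hL, hLC⟩ := exists_isLine hab
    exact ⟨L, hL, by rw [hLC, eq_neg_of_add_eq_zero_right h]⟩

/-- A hyperplane through `a` is a translated kernel, and `d' i - a = -(d i - a)` makes the condition
on `d' i` automatic. -/
theorem exists_isHyperplane_iff {ι : Type*} {S : Finset ι} {a : AG43}
    {d d' : ι → AG43} (h : ∀ i, a + d i + d' i = 0) :
    (∃ H : AffineSubspace 𝔽 AG43, IsHyperplane H ∧ ∀ i ∈ S, a ∈ H ∧ d i ∈ H ∧ d' i ∈ H) ↔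
      ∃ f : Dual 𝔽 AG43, f ≠ 0 ∧ ∀ i ∈ S, f (d i - a) = 0 := by
  constructor
  · rintro ⟨H, hH, hmem⟩
    have hlt : H.direction < ⊤ := by
      rw [lt_top_iff_ne_top]
      intro htop
      rw [IsHyperplane, htop, finrank_top] at hH
      simp at hH
    obtain ⟨f, hf, hle⟩ := Submodule.exists_le_ker_of_lt_top _ hlt
    refine ⟨f, hf, fun i hi => ?_⟩
    exact hle (AffineSubspace.vsub_mem_direction (hmem i hi).2.1 (hmem i hi).1)
  · rintro ⟨f, hf, hker⟩
    refine ⟨AffineSubspace.mk' a (LinearMap.ker f), ?_, fun i hi => ⟨?_, ?_, ?_⟩⟩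
    · have h1 := f.finrank_range_add_finrank_ker
      rw [LinearMap.range_eq_top.2 (LinearMap.surjective hf), finrank_top, finrank_self,
        finrank_fin_fun] at h1
      rw [IsHyperplane, AffineSubspace.direction_mk']
      exact Nat.add_left_cancel (n := 1) h1
    · exact AffineSubspace.self_mem_mk' _ _
    · exact hker i hi
    · have h3 := three_nsmul_eq_zero a
      have : d' i - a = -(d i - a) := by
        rw [eq_neg_of_add_eq_zero_right (h i), ← sub_eq_zero,
          show -(a + d i) - a - -(d i - a) = -(a + a + a) by abel, h3, neg_zero]
      rw [AffineSubspace.mem_mk', vsub_eq_sub, this]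
      exact neg_mem (hker i hi)

end Geometry

/-! ### Demicaps as block-free five-point sets -/

section Demicaps

/-- Maximality gives at least 20 points; any 20 of them form an elliptic cap, whose completeness
leaves no room for more. -/
theorem IsMaximalCap.exists_eq_transport {C : Finset AG43} (hC : IsMaximalCap C) :
    ∃ e : (𝔽 × 𝔽 × 𝔽 × 𝔽) ≃ᵃ[𝔽] AG43, C = transport e ellipticCap := by
  let φ : AG43 ≃ᵃ[𝔽] 𝔽 × 𝔽 × 𝔽 × 𝔽 :=
    (LinearEquiv.ofFinrankEq AG43 (𝔽 × 𝔽 × 𝔽 × 𝔽) (by simp)).toAffineEquiv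
  have hlf : LineFree (transport φ C) := (isCap_iff_lineFree.1 hC.1).map_affineEquiv φ
  have hcard : 20 ≤ #(transport φ C) := by
    have := hC.2 (transport φ.symm ellipticCap)
      (isCap_iff_lineFree.2 (lineFree_ellipticCap.map_affineEquiv φ.symm))
    rwa [card_transport, card_ellipticCap, ← card_transport φ C] at this
  obtain ⟨D, hDC, hD⟩ := Finset.exists_subset_card_eq hcard
  obtain ⟨g, hg⟩ := (hlf.mono hDC).exists_transport_eq_ellipticCap hD
  have h := (hlf.map_affineEquiv g).eq_ellipticCap (by
    rw [← hg]
    exact Finset.map_subset_map.2 hDC)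
  refine ⟨(φ.trans g).symm, ?_⟩
  ext x
  rw [mem_transport, ← h, ← transport_trans]
  exact apply_mem_transport.symm

theorem quadricPoint_mem_pointsOver {I : Finset (Fin 10)} {i : Fin 10} :
    quadricPoint i ∈ pointsOver I ↔ i ∈ I := by
  simp only [pointsOver, mem_union, mem_image]
  constructor
  · rintro (⟨j, hj, h⟩ | ⟨j, hj, h⟩)
    · rwa [quadricPoint_injective i j (.inl h.symm)]
    · rwa [quadricPoint_injective i j (.inr h.symm)]
  · exact fun h => .inl ⟨i, h, rfl⟩

theorem neg_quadricPoint_mem_pointsOver {I : Finset (Fin 10)} {i : Fin 10} :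
    -quadricPoint i ∈ pointsOver I ↔ i ∈ I := by
  simp only [pointsOver, mem_union, mem_image]
  constructor
  · rintro (⟨j, hj, h⟩ | ⟨j, hj, h⟩)
    · rwa [quadricPoint_injective i j (.inr (by rw [h, neg_neg]))]
    · rwa [quadricPoint_injective i j (.inl (neg_injective h.symm))]
  · exact fun h => .inr ⟨i, h, rfl⟩

theorem mem_pointsOver_compl {I : Finset (Fin 10)} {x : 𝔽 × 𝔽 × 𝔽 × 𝔽} :
    x ∈ pointsOver Iᶜ ↔ x ∈ ellipticCap ∧ x ∉ pointsOver I := by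
  constructor
  · intro h
    have hx : x ∈ ellipticCap := by
      simp only [pointsOver, mem_union, mem_image] at h
      rw [mem_ellipticCap_iff]
      obtain ⟨i, -, h⟩ | ⟨i, -, h⟩ := h
      exacts [⟨i, .inl h.symm⟩, ⟨i, .inr h.symm⟩]
    refine ⟨hx, ?_⟩
    obtain ⟨i, rfl | rfl⟩ := (mem_ellipticCap_iff x).1 hx
    · rwa [quadricPoint_mem_pointsOver, mem_compl, ← quadricPoint_mem_pointsOver] at h
    · rwa [neg_quadricPoint_mem_pointsOver, mem_compl, ← neg_quadricPoint_mem_pointsOver] at h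
  · rintro ⟨hx, h⟩
    obtain ⟨i, rfl | rfl⟩ := (mem_ellipticCap_iff x).1 hx
    · rwa [quadricPoint_mem_pointsOver, mem_compl, ← quadricPoint_mem_pointsOver]
    · rwa [neg_quadricPoint_mem_pointsOver, mem_compl, ← neg_quadricPoint_mem_pointsOver]

theorem pointsOver_subset (I : Finset (Fin 10)) : pointsOver I ⊆ ellipticCap := by
  intro x hx
  rw [← compl_compl I] at hx
  exact (mem_pointsOver_compl.1 hx).1

theorem pointsOver_injective : Function.Injective pointsOver := by
  intro I J h
  ext i
  rw [← quadricPoint_mem_pointsOver, h, quadricPoint_mem_pointsOver]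

theorem exists_linearForm (f : Dual 𝔽 (𝔽 × 𝔽 × 𝔽 × 𝔽)) : ∃ c, ∀ v, f v = linearForm c v := by
  refine ⟨(f (1, 0, 0, 0), f (0, 1, 0, 0), f (0, 0, 1, 0), f (0, 0, 0, 1)), fun v => ?_⟩
  have : v = v.1 • (1, 0, 0, 0) + v.2.1 • (0, 1, 0, 0) + v.2.2.1 • (0, 0, 1, 0) +
      v.2.2.2 • (0, 0, 0, 1) := by
    ext <;> simp
  conv_lhs => rw [this]
  simp only [map_add, map_smul, smul_eq_mul, linearForm]
  ring

theorem exists_dual_eq_linearForm (c : 𝔽 × 𝔽 × 𝔽 × 𝔽) :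
    ∃ f : Dual 𝔽 (𝔽 × 𝔽 × 𝔽 × 𝔽), ∀ v, f v = linearForm c v :=
  ⟨{ toFun := linearForm c
     map_add' := fun x y => by simp only [linearForm, Prod.fst_add, Prod.snd_add]; ring
     map_smul' := fun r x => by
      simp only [linearForm, Prod.smul_fst, Prod.smul_snd, smul_eq_mul, RingHom.id_apply]; ring },
    fun _ => rfl⟩

theorem linearForm_zero_left (v : 𝔽 × 𝔽 × 𝔽 × 𝔽) : linearForm 0 v = 0 := by
  simp [linearForm]

theorem linearForm_neg (c v : 𝔽 × 𝔽 × 𝔽 × 𝔽) : linearForm c (-v) = -linearForm c v := by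
  simp only [linearForm, Prod.fst_neg, Prod.snd_neg]; ring

theorem eq_zero_of_linearForm_eq_zero : ∀ c, (∀ v, linearForm c v = 0) → c = 0 := by
  decide +kernel

variable (e : (𝔽 × 𝔽 × 𝔽 × 𝔽) ≃ᵃ[𝔽] AG43)

/-- Hyperplanes through the image of the centre of the elliptic cap, in terms of linear forms. -/
theorem exists_isHyperplane_transport_iff {S : Finset (Fin 5)}
    {d d' : Fin 5 → 𝔽 × 𝔽 × 𝔽 × 𝔽} (h : ∀ i, d i + d' i = 0) :
    (∃ H : AffineSubspace 𝔽 AG43, IsHyperplane H ∧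
      ∀ i ∈ S, e 0 ∈ H ∧ e (d i) ∈ H ∧ e (d' i) ∈ H) ↔
      ∃ c ≠ 0, ∀ i ∈ S, linearForm c (d i) = 0 := by
  have he : ∀ v, e v - e 0 = e.linear v := fun v => by
    simpa using (e.toAffineMap.linearMap_vsub v 0).symm
  rw [exists_isHyperplane_iff fun i => by rw [add_eq_zero_iff, zero_add, h]]
  simp only [he]
  constructor
  · rintro ⟨f, hf, hS⟩
    obtain ⟨c, hc⟩ := exists_linearForm (f.comp (e.linear : _ →ₗ[𝔽] AG43))
    refine ⟨c, ?_, fun i hi => ?_⟩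
    · rintro rfl
      refine hf (LinearMap.ext fun x => ?_)
      have := hc (e.linear.symm x)
      rw [linearForm_zero_left] at this
      simpa using this
    · rw [← hc]
      exact hS i hi
  · rintro ⟨c, hc, hS⟩
    obtain ⟨f, hf⟩ := exists_dual_eq_linearForm c
    refine ⟨f.comp (e.linear.symm : AG43 →ₗ[𝔽] _), ?_, fun i hi => ?_⟩
    · intro h0
      refine hc (eq_zero_of_linearForm_eq_zero c fun v => ?_)
      have := LinearMap.congr_fun h0 (e.linear v)
      rw [← hf]
      simpa using this
    · simpa [hf] using hS i hi

theorem isDemicap_transport_pointsOver {I : Finset (Fin 10)} (hI : I ∈ quintets) :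
    IsDemicap (transport e (pointsOver I)) := by
  obtain ⟨h5, hI⟩ := mem_quintets_iff.1 hI
  let j : Fin 5 ↪o Fin 10 := I.orderEmbOfFin h5
  have hj : Finset.univ.image j = I := Finset.image_orderEmbOfFin_univ I h5
  refine ⟨e 0, ?_, fun i => e (quadricPoint (j i)), fun i => e (-quadricPoint (j i)), ?_, ?_, ?_, ?_⟩
  · exact isCap_iff_lineFree.2
      ((lineFree_ellipticCap.mono (pointsOver_subset I)).map_affineEquiv e)
  · refine Function.Injective.sumElim ?_ ?_ ?_
    · exact fun i i' h => j.injective (quadricPoint_injective _ _ (.inl (e.injective h)))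
    · exact fun i i' h =>
        j.injective (quadricPoint_injective _ _ (.inl (neg_injective (e.injective h))))
    · intro i i' h
      have h1 := e.injective h
      have h2 := quadricPoint_injective _ _ (.inr h1)
      rw [h2] at h1
      exact quadricPoint_ne_neg _ h1
  · rw [transport, pointsOver, ← hj, Finset.map_eq_image, Finset.image_union, Finset.image_image,
      Finset.image_image, Finset.image_image, Finset.image_image]
    rfl
  · intro i
    rw [isALine_iff, add_eq_zero_iff]
    refine ⟨fun h => ?_, by abel⟩
    have := (mem_ellipticCap_iff (quadricPoint (j i))).2 ⟨j i, .inl rfl⟩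
    rw [← e.injective h] at this
    simp [ellipticCap] at this
  · intro S hS
    rw [exists_isHyperplane_transport_iff e fun i => add_neg_cancel _]
    rintro ⟨c, hc, h⟩
    refine hc (hI (S.map j.toEmbedding) ?_ (by rw [Finset.card_map, hS]) c ?_)
    · rw [← hj, Finset.map_eq_image]
      exact Finset.image_subset_image (Finset.subset_univ S)
    · intro i hi
      obtain ⟨k, hk, rfl⟩ := Finset.mem_map.1 hi
      exact h k hk

theorem IsDemicap.exists_eq_transport {D : Finset AG43} (hD : IsDemicap D)
    (hDC : D ⊆ transport e ellipticCap) : ∃ I ∈ quintets, D = transport e (pointsOver I) := by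
  obtain ⟨a, -, d, d', hinj, hDd, hline, hhyp⟩ := hD
  obtain ⟨a, rfl⟩ := e.surjective a
  obtain ⟨d, rfl⟩ : ∃ x, d = fun i => e (x i) := ⟨fun i => e.symm (d i), by simp⟩
  obtain ⟨d', rfl⟩ : ∃ x, d' = fun i => e (x i) := ⟨fun i => e.symm (d' i), by simp⟩
  simp only [isALine_iff, add_eq_zero_iff] at hline
  have hd : ∀ i, d i ∈ ellipticCap := fun i => by
    rw [← apply_mem_transport (e := e)]
    exact hDC (by rw [hDd]; simp)
  have hd' : ∀ i, d' i ∈ ellipticCap := fun i => by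
    rw [← apply_mem_transport (e := e)]
    exact hDC (by rw [hDd]; simp)
  have hinj' : Function.Injective (Sum.elim d d') := by
    have : Sum.elim (fun i => e (d i)) (fun i => e (d' i)) = e ∘ Sum.elim d d' := by
      ext x; cases x <;> rfl
    rw [this] at hinj
    exact hinj.of_comp
  -- Another anchor would give ten points where `card_secants_le` allows nine.
  have ha : a = 0 := by
    by_contra ha
    have h10 : #(univ.image (Sum.elim d d')) = 10 := by
      rw [Finset.card_image_of_injective _ hinj']; rfl
    have hsub : univ.image (Sum.elim d d') ⊆ {x ∈ ellipticCap | -(a + x) ∈ ellipticCap} := by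
      intro x hx
      obtain ⟨i, -, rfl⟩ := Finset.mem_image.1 hx
      rw [Finset.mem_filter]
      cases i with
      | inl i =>
        refine ⟨hd i, ?_⟩
        rw [Sum.elim_inl, ← eq_neg_of_add_eq_zero_right (hline i).2]
        exact hd' i
      | inr i =>
        refine ⟨hd' i, ?_⟩
        rw [Sum.elim_inr, ← eq_neg_of_add_eq_zero_right (a := a + d' i) (b := d i)
          (by rw [← (hline i).2]; abel)]
        exact hd i
    have := (Finset.card_le_card hsub).trans (card_secants_le ha)
    omega
  subst ha
  have hneg : ∀ i, d' i = -d i := fun i => by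
    rw [eq_neg_of_add_eq_zero_right (hline i).2, zero_add]
  choose j hj using fun i => (mem_ellipticCap_iff (d i)).1 (hd i)
  -- Two pairs over the same quadric point would share a point.
  have hjinj : Function.Injective j := by
    intro i i' h
    have hi := hj i
    rw [h] at hi
    have hcases : d i = d i' ∨ d i = d' i' := by
      rw [hneg]
      obtain hi | hi := hi <;> obtain hi' | hi' := hj i' <;> simp [hi, hi']
    obtain h | h := hcases
    · exact Sum.inl_injective (@hinj' (.inl i) (.inl i') h)
    · exact absurd (@hinj' (.inl i) (.inr i') h) (by simp)
  refine ⟨univ.image j, ?_, ?_⟩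
  · rw [mem_quintets_iff]
    refine ⟨by rw [Finset.card_image_of_injective _ hjinj]; rfl, fun B hB hB4 c hc => ?_⟩
    obtain ⟨S, -, rfl⟩ := Finset.subset_image_iff.1 hB
    rw [Finset.card_image_of_injective _ hjinj] at hB4
    by_contra hc0
    refine hhyp S hB4 ((exists_isHyperplane_transport_iff e fun i => ?_).2 ⟨c, hc0, fun i hi => ?_⟩)
    · rw [hneg, add_neg_cancel]
    · have := hc (j i) (Finset.mem_image_of_mem j hi)
      obtain hi | hi := hj i
      · rw [hi, this]
      · rw [hi, linearForm_neg, this, neg_zero]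
  · ext x
    obtain ⟨x, rfl⟩ := e.surjective x
    rw [apply_mem_transport, hDd]
    simp only [mem_union, mem_image, mem_univ, true_and, e.injective.eq_iff, pointsOver,
      exists_exists_eq_and, hneg, ← exists_or]
    refine exists_congr fun i => ?_
    obtain hi | hi := hj i
    · rw [hi]
    · rw [hi, neg_neg, or_comm]

end Demicaps

end AffineCap

/-! ### Complements and the count of decompositions -/

open AffineCap Finset in
theorem mainTheorem6 (C : Finset AffineCap.AG43) (hC : AffineCap.IsMaximalCap C) :
    (∀ D : Finset AffineCap.AG43, AffineCap.IsDemicap D → D ⊆ C → AffineCap.IsDemicap (C \ D)) ∧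
      (AffineCap.demicapDecompositions C).ncard = 36 := by
  obtain ⟨e, rfl⟩ := hC.exists_eq_transport
  have hsdiff : ∀ I, transport e ellipticCap \ transport e (pointsOver I) =
      transport e (pointsOver Iᶜ) := by
    intro I
    ext x
    rw [mem_sdiff, mem_transport, mem_transport, mem_transport, mem_pointsOver_compl]
  have hinj : Function.Injective fun I => transport e (pointsOver I) := fun I J h =>
    pointsOver_injective (Finset.map_injective _ h)
  have hsub : ∀ I, transport e (pointsOver I) ⊆ transport e ellipticCap := fun I =>
    Finset.map_subset_map.2 (pointsOver_subset I)
  refine ⟨fun D hD hDC => ?_, ?_⟩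
  · obtain ⟨I, hI, rfl⟩ := hD.exists_eq_transport e hDC
    rw [hsdiff]
    exact isDemicap_transport_pointsOver e (compl_mem_quintets hI)
  · let s : Finset (Fin 10) → Sym2 (Finset AG43) := fun I =>
      s(transport e (pointsOver I), transport e (pointsOver Iᶜ))
    have heq : demicapDecompositions (transport e ellipticCap) =
        s '' ({I ∈ quintets | 0 ∈ I} : Finset (Finset (Fin 10))) := by
      ext p
      constructor
      · rintro ⟨D, D', rfl, hD, hD', hdisj, hunion⟩
        obtain ⟨I, hI, rfl⟩ := hD.exists_eq_transport e (hunion ▸ Finset.subset_union_left)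
        have : D' = transport e (pointsOver Iᶜ) := by
          rw [← hsdiff, ← hunion, Finset.union_sdiff_cancel_left hdisj]
        subst this
        -- Each unordered pair is indexed by its member containing the quadric point 0.
        by_cases h0 : 0 ∈ I
        · exact ⟨I, by simp [hI, h0], rfl⟩
        · refine ⟨Iᶜ, by simp [compl_mem_quintets hI, h0], ?_⟩
          simp only [s, compl_compl]
          exact Sym2.eq_swap
      · rintro ⟨I, hI, rfl⟩
        have hI' : I ∈ quintets := (Finset.mem_filter.1 hI).1
        refine ⟨_, _, rfl, isDemicap_transport_pointsOver e hI',
          isDemicap_transport_pointsOver e (compl_mem_quintets hI'), ?_, ?_⟩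
        · rw [← hsdiff]
          exact Finset.disjoint_sdiff
        · rw [← hsdiff]
          exact Finset.union_sdiff_of_subset (hsub I)
    rw [heq, Set.InjOn.ncard_image, Set.ncard_coe_finset, card_quintets_zero_mem]
    intro I hI J hJ h
    obtain ⟨h, -⟩ | ⟨h, -⟩ := Sym2.eq_iff.1 h
    · exact hinj h
    -- The swapped case makes I the complement of J, yet both contain 0.
    · have := hinj h
      rw [mem_coe, mem_filter] at hI hJ
      rw [this] at hI
      exact absurd hJ.2 (Finset.mem_compl.1 hI.2)
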